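/- Let $\mathbb{F}$ be a field, $A$ a finite-dimensional $\mathbb{F}$-algebra, $\sigma$ an $\mathbb{F}$-algebra automorphism of $A$, and $\delta : A \to A$ an $\mathbb{F}$-linear map with $\delta(ab)=\sigma(a)\delta(b)+\delta(a)b$ for all $a,b\in A$. Put $\sigma'=\sigma^{-1}$, $\delta' = -\delta\sigma^{-1}$, and assume that $\delta$ and $\delta'$ are both nilpotent. Let $A[X;\sigma,\delta]$ be the skew polynomial ring, with left coefficients and $Xa=\sigma(a)X+\delta(a)$ for $a\in A$, and let $A((X;\sigma,\delta))$ be the skew Laurent series ring: the left $A$-module $A((X))$ with the product whose coefficients are $$\Big(\sum_i s_iX^i\Big)t = \sum_i s_i\,(X^i t),\qquad X\sum_j t_jX^j=\sum_j\big(\sigma(t_j)X^{j+1}+\delta(t_j)X^j\big),\qquad X^{-1}\sum_j t_jX^j=\sum_j\sum_{l\ge 0}\sigma'\delta'^{\,l}(t_j)X^{j-1-l},$$ in which, by nilpotency of $\delta$ and $\delta'$, only finitely many terms contribute to each coefficient. It contains $A[X;\sigma,\delta]$ as a subring. Let $n,k\ge 0$ be integers and let $\mathbb{F}^n$ carry a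 right $A$-module structure that is compatible with its $\mathbb{F}$-vector space structure. The same formula $\left(\sum_i s_iX^i\right)t=\sum_i s_i\,(X^it)$, with $s_i\in\mathbb{F}^n$, makes $\mathbb{F}^n((X))$ a right $A((X;\sigma,\delta))$-module and $\mathbb{F}^n[X]$ a right $A[X;\sigma,\delta]$-module; in particular $\mathbb{F}^n((X))$ is a right $A$-module by restriction of scalars. A convolutional code of rate $k/n$ is a $k$-dimensional $\mathbb{F}((X))$-vector subspace of $\mathbb{F}^n((X))$ that has a basis consisting of elements of $\mathbb{F}^n[X]$. It is $(\sigma,\delta,A)$-cyclic if it is also a right $A$-submodule of $\mathbb{F}^n((X))$. Then the map $\mathcal{D}\mapsto \mathcal{D}\cap\mathbb{F}^n[X]$ is a bijection from the set of all $(\sigma,\delta,A)$-cyclic convolutional codes of rate $k/n$ onto the set of all right $A[X;\sigma,\delta]$-submodules of $\mathbb{F}^n[X]$ that are $\mathbb{F}[X]$-direct summands of rank $k$ of $\mathbb{F}^n[X]$. -/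

import Mathlib

open MulOpposite

noncomputable section

/-! ### Left skew derivations -/

/-- A left skew derivation `(σ, δ)` on the `F`-algebra `A`, with `σ` an `F`-algebra automorphism
and `δ` an `F`-linear map. -/
structure LeftSkewDerivation (F A : Type*) [Field F] [Ring A] [Algebra F A] where
  σ : A ≃ₐ[F] A
  δ : Module.End F A
  δ_mul : ∀ a b : A, δ (a * b) = σ a * δ b + δ a * b

namespace LeftSkewDerivation

section Basic

variable {F A : Type*} [Field F] [Ring A] [Algebra F A] (S : LeftSkewDerivation F A)

/-- `δ' = -δ ∘ σ⁻¹`, so that `a X = X σ⁻¹(a) + δ'(a)`. -/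
def δ' : Module.End F A := -(S.δ ∘ₗ S.σ.symm.toLinearMap)

/-- Both `δ` and `δ'` are nilpotent. -/
class IsBiNilpotent : Prop where
  nil_δ : IsNilpotent S.δ
  nil_δ' : IsNilpotent S.δ'

theorem δ_one : S.δ 1 = 0 := by
  have h := S.δ_mul 1 1
  simpa using h

theorem δ_symm (a : A) : S.δ (S.σ.symm a) = -S.δ' a := by simp [δ']

theorem δ_eq (a : A) : S.δ a = -S.δ' (S.σ a) := by simp [δ']

end Basic

/-! ### The skew polynomial ring `A[X;σ,δ]` -/

/-- The underlying left `A`-module `A[X]` of the skew polynomial ring `A[X;σ,δ]`: the coefficients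
`f_i` of `∑ f_i X^i`. -/
@[ext]
structure SkewPoly {F A : Type*} [Field F] [Ring A] [Algebra F A]
    (S : LeftSkewDerivation F A) where
  coeff : ℕ →₀ A

section SkewPoly

variable {F A : Type*} [Field F] [Ring A] [Algebra F A] (S : LeftSkewDerivation F A)
variable {M : Type*} [AddCommGroup M] [Module Aᵐᵒᵖ M]

/-- Left multiplication by `X` on coefficient sequences of polynomials:
`X (∑ f_j X^j) = ∑ σ(f_j) X^(j+1) + ∑ δ(f_j) X^j`. -/
def polyX : AddMonoid.End (ℕ →₀ A) :=
  Finsupp.liftAddHom fun j =>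
    (Finsupp.singleAddHom (j + 1)).comp (S.σ : A →+ A) +
      (Finsupp.singleAddHom j).comp S.δ.toAddMonoidHom

theorem polyX_single (j : ℕ) (a : A) : S.polyX (Finsupp.single j a) =
    Finsupp.single (j + 1) (S.σ a) + Finsupp.single j (S.δ a) := by
  refine (Finsupp.liftAddHom_apply_single _ _ _).trans rfl

/-- `m (∑ f_j X^j) = ∑ (m f_j) X^j` for `m` in a right `A`-module `M`, biadditively. -/
def polyCoeffMul : M →+ (ℕ →₀ A) →+ (ℕ →₀ M) :=
  AddMonoidHom.flip <| Finsupp.liftAddHom fun j =>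
    AddMonoidHom.mk' (fun a => AddMonoidHom.mk' (fun m => Finsupp.single j (op a • m))
      (fun x y => by simp)) (fun a b => by ext; simp [add_smul])

@[simp]
theorem polyCoeffMul_single (m : M) (j : ℕ) (a : A) :
    polyCoeffMul m (Finsupp.single j a) = Finsupp.single j (op a • m) := by
  simp [polyCoeffMul]

/-- The product `(∑ m_i X^i) f = ∑ m_i (X^i f)`, for `∑ m_i X^i` in `M[X]` and `f` in
`A[X;σ,δ]`, biadditively. -/
def polyAct : (ℕ →₀ M) →+ (ℕ →₀ A) →+ (ℕ →₀ M) :=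
  Finsupp.liftAddHom fun i => AddMonoidHom.mk'
    (fun m => AddMonoidHom.comp (polyCoeffMul m) (S.polyX ^ i))
    (fun x y => AddMonoidHom.ext fun f => by
      change polyCoeffMul (x + y) ((S.polyX ^ i) f) =
        polyCoeffMul x ((S.polyX ^ i) f) + polyCoeffMul y ((S.polyX ^ i) f)
      rw [map_add, AddMonoidHom.add_apply])

theorem polyAct_single (i : ℕ) (m : M) (f : ℕ →₀ A) :
    S.polyAct (Finsupp.single i m) f = polyCoeffMul m ((S.polyX ^ i) f) :=
  DFunLike.congr_fun (Finsupp.liftAddHom_apply_single _ _ _) f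

theorem polyCoeffMul_polyAct (m : M) (f g : ℕ →₀ A) :
    polyCoeffMul m (S.polyAct f g) = S.polyAct (polyCoeffMul m f) g := by
  induction f using Finsupp.induction_linear with
  | zero => simp
  | add f f' h h' => simp [h, h']
  | single j a =>
    rw [polyCoeffMul_single, polyAct_single, polyAct_single]
    generalize (S.polyX ^ j) g = r
    induction r using Finsupp.induction_linear with
    | zero => simp
    | add f f' h h' => simp [h, h']
    | single k b => simp only [polyCoeffMul_single, op_smul_eq_mul, op_mul, mul_smul]

theorem polyX_polyCoeffMul (a : A) (g : ℕ →₀ A) :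
    S.polyX (polyCoeffMul a g) = polyCoeffMul (S.σ a) (S.polyX g) + polyCoeffMul (S.δ a) g := by
  induction g using Finsupp.induction_linear with
  | zero => simp
  | add f f' h h' => simp only [map_add, h, h']; abel
  | single k b =>
    simp only [polyCoeffMul_single, polyX_single, op_smul_eq_mul, map_add, map_mul, S.δ_mul,
      Finsupp.single_add]
    abel

theorem polyX_polyAct (f g : ℕ →₀ A) :
    S.polyX (S.polyAct f g) = S.polyAct (S.polyX f) g := by
  induction f using Finsupp.induction_linear with
  | zero => simp
  | add f f' h h' => simp [h, h']
  | single j a =>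
    simp only [polyAct_single, polyX_polyCoeffMul, polyX_single, map_add,
      AddMonoidHom.add_apply, pow_succ']
    rfl

theorem polyX_pow_polyAct (i : ℕ) (f g : ℕ →₀ A) :
    (S.polyX ^ i) (S.polyAct f g) =
      S.polyAct ((S.polyX ^ i) f) g := by
  induction i with
  | zero => simp
  | succ i ih =>
    rw [pow_succ']
    change S.polyX ((S.polyX ^ i) _) =
      S.polyAct (S.polyX ((S.polyX ^ i) _)) _
    rw [ih, polyX_polyAct]

theorem polyAct_polyAct (p : ℕ →₀ M) (f g : ℕ →₀ A) :
    S.polyAct (S.polyAct p f) g = S.polyAct p (S.polyAct f g) := by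
  induction p using Finsupp.induction_linear with
  | zero => simp
  | add f f' h h' => simp [h, h']
  | single j a =>
    rw [polyAct_single, polyAct_single, ← polyCoeffMul_polyAct, polyX_pow_polyAct]

theorem polyX_pow_one (i : ℕ) : (S.polyX ^ i) (Finsupp.single 0 1) =
    Finsupp.single i 1 := by
  induction i with
  | zero => simp
  | succ i ih =>
    rw [pow_succ']
    change S.polyX ((S.polyX ^ i) _) = _
    rw [ih, polyX_single]
    simp [δ_one]

theorem polyAct_one (p : ℕ →₀ M) : S.polyAct p (Finsupp.single 0 1) = p := by
  induction p using Finsupp.induction_linear with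
  | zero => simp
  | add f f' h h' => simp [h, h']
  | single j a => simp [polyAct_single, polyX_pow_one]

theorem one_polyAct (f : ℕ →₀ A) : S.polyAct (Finsupp.single 0 (1 : A)) f = f := by
  rw [polyAct_single]
  induction f using Finsupp.induction_linear with
  | zero => simp
  | add f f' h h' => simp only [map_add, h, h']
  | single j a => simp

namespace SkewPoly

variable {S}

/-- A skew polynomial is determined by its coefficients. -/
def coeffEquiv : SkewPoly S ≃ (ℕ →₀ A) := ⟨coeff, mk, fun _ => rfl, fun _ => rfl⟩

instance : AddCommGroup (SkewPoly S) := coeffEquiv.addCommGroup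

@[simp] theorem coeff_zero : (0 : SkewPoly S).coeff = 0 := rfl
@[simp] theorem coeff_add (f g : SkewPoly S) : (f + g).coeff = f.coeff + g.coeff := rfl

instance : Mul (SkewPoly S) := ⟨fun f g => ⟨S.polyAct f.coeff g.coeff⟩⟩
instance : One (SkewPoly S) := ⟨⟨Finsupp.single 0 1⟩⟩

theorem coeff_mul (f g : SkewPoly S) : (f * g).coeff = S.polyAct f.coeff g.coeff := rfl
theorem coeff_one : (1 : SkewPoly S).coeff = Finsupp.single 0 1 := rfl

/-- The skew polynomial ring `A[X;σ,δ]`. -/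
instance : Ring (SkewPoly S) where
  __ := (inferInstance : AddCommGroup (SkewPoly S))
  left_distrib f g h := by ext1; simp [coeff_mul]
  right_distrib f g h := by ext1; simp [coeff_mul]
  zero_mul f := by ext1; simp [coeff_mul]
  mul_zero f := by ext1; simp [coeff_mul]
  mul_assoc f g h := by ext1; simp [coeff_mul, polyAct_polyAct]
  one_mul f := by ext1; simp [coeff_mul, coeff_one, one_polyAct]
  mul_one f := by ext1; simp [coeff_mul, coeff_one, polyAct_one]

/-- The monomial `a X^i`. -/
def monomial (i : ℕ) (a : A) : SkewPoly S := ⟨Finsupp.single i a⟩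

/-- The defining relation `X a = σ(a) X + δ(a)`. -/
theorem X_mul (a : A) : (monomial 1 1 * monomial 0 a : SkewPoly S) =
    monomial 1 (S.σ a) + monomial 0 (S.δ a) := by
  ext1
  simp [coeff_mul, monomial, polyAct_single, polyX_single]

theorem monomial_mul_X (a : A) (i j : ℕ) : (monomial i a * monomial j 1 : SkewPoly S) =
    monomial (i + j) a := by
  ext1
  rw [coeff_mul]
  simp only [monomial]
  rw [polyAct_single, ← S.polyX_pow_one j]
  change polyCoeffMul a ((S.polyX ^ i * S.polyX ^ j) (Finsupp.single 0 1)) = _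
  rw [← pow_add, polyX_pow_one]
  simp

/-- For a right `A`-module `M` over the `F`-algebra `A`, the polynomials `M[X]` are a right
`A[X;σ,δ]`-module. -/
instance [Module F M] : Module (SkewPoly S)ᵐᵒᵖ (PolynomialModule F M) where
  smul f p := .ofCoeff F (S.polyAct p.coeff f.unop.coeff)
  one_smul p := congrArg (PolynomialModule.ofCoeff F) (S.polyAct_one p.coeff)
  mul_smul f g p :=
    congrArg (PolynomialModule.ofCoeff F) (S.polyAct_polyAct p.coeff _ _).symm
  smul_zero f := congrArg (PolynomialModule.ofCoeff F)
    (by simp : S.polyAct (0 : ℕ →₀ M) f.unop.coeff = 0)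
  smul_add f p q := congrArg (PolynomialModule.ofCoeff F)
    (by simp : S.polyAct (p.coeff + q.coeff) f.unop.coeff =
      S.polyAct p.coeff f.unop.coeff + S.polyAct q.coeff f.unop.coeff)
  add_smul f g p := congrArg (PolynomialModule.ofCoeff F)
    (map_add (S.polyAct p.coeff) f.unop.coeff g.unop.coeff)
  zero_smul p := congrArg (PolynomialModule.ofCoeff F) (map_zero (S.polyAct p.coeff))

theorem coeff_op_smul [Module F M] (f : SkewPoly S) (p : PolynomialModule F M) :
    (op f • p).coeff = S.polyAct p.coeff f.coeff := rfl

end SkewPoly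

end SkewPoly

/-! ### The skew Laurent series ring `A((X;σ,δ))` -/

section Laurent

variable {F A : Type*} [Field F] [Ring A] [Algebra F A] (S : LeftSkewDerivation F A)
variable {M : Type*} [AddCommGroup M] [Module Aᵐᵒᵖ M]

/-- The coefficients of `X t`, that is `(X t)_k = σ(t_{k-1}) + δ(t_k)`. -/
def mulX : Module.End F (ℤ → A) where
  toFun t k := S.σ (t (k - 1)) + S.δ (t k)
  map_add' s t := by ext k; simp only [Pi.add_apply, map_add]; abel
  map_smul' c t := by ext k; simp

/-- The coefficients of `X⁻¹ t`, where `X⁻¹ a = ∑_l σ'δ'^l(a) X^(-1-l)` with `σ' = σ⁻¹`; the sum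
is finite because `δ'` is nilpotent. -/
def mulXInv : Module.End F (ℤ → A) where
  toFun t k := ∑ l ∈ Finset.range (nilpotencyClass S.δ'), S.σ.symm ((S.δ' ^ l) (t (k + 1 + l)))
  map_add' s t := by ext k; simp [Finset.sum_add_distrib]
  map_smul' c t := by ext k; simp [Finset.smul_sum]

/-- The coefficient sequence `s` vanishes below degree `o`. -/
def VanishBelow {B : Type*} [Zero B] (o : ℤ) (s : ℤ → B) : Prop := ∀ k < o, s k = 0

theorem vanishBelow_mulXInv {o : ℤ} {t : ℤ → A} (h : VanishBelow o t) :
    VanishBelow (o - nilpotencyClass S.δ') (S.mulXInv t) := fun k hk => by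
  refine Finset.sum_eq_zero (s := Finset.range (nilpotencyClass S.δ')) fun l hl => ?_
  have := Finset.mem_range.mp hl
  change S.σ.symm ((S.δ' ^ l) (t (k + 1 + l))) = 0
  rw [h _ (by omega), map_zero, map_zero]

variable [S.IsBiNilpotent]

theorem δ_pow_class : S.δ ^ nilpotencyClass S.δ = 0 :=
  pow_nilpotencyClass IsBiNilpotent.nil_δ

theorem δ'_pow_class : S.δ' ^ nilpotencyClass S.δ' = 0 :=
  pow_nilpotencyClass IsBiNilpotent.nil_δ'

theorem mulX_mulXInv (t : ℤ → A) : S.mulX (S.mulXInv t) = t := by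
  ext k
  have h := Finset.sum_range_sub' (fun l : ℕ => (S.δ' ^ l) (t (k + l))) (nilpotencyClass S.δ')
  rw [δ'_pow_class] at h
  simp only [mulX, mulXInv, LinearMap.coe_mk, AddHom.coe_mk, map_sum, AlgEquiv.apply_symm_apply,
    δ_symm, ← Finset.sum_add_distrib]
  simp only [pow_zero, Module.End.one_apply, Nat.cast_zero, add_zero, LinearMap.zero_apply,
    sub_zero] at h
  rw [← h]
  refine Finset.sum_congr rfl fun l _ => ?_
  rw [sub_add_cancel, pow_succ', Module.End.mul_apply, ← sub_eq_add_neg]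
  congr 4
  push_cast
  ring_nf

theorem mulXInv_mulX (t : ℤ → A) : S.mulXInv (S.mulX t) = t := by
  ext k
  have h := Finset.sum_range_sub' (fun l : ℕ => S.σ.symm ((S.δ' ^ l) (S.σ (t (k + l)))))
    (nilpotencyClass S.δ')
  rw [δ'_pow_class] at h
  simp only [mulX, mulXInv, LinearMap.coe_mk, AddHom.coe_mk]
  simp only [pow_zero, Module.End.one_apply, Nat.cast_zero, add_zero, LinearMap.zero_apply,
    sub_zero, map_zero, AlgEquiv.symm_apply_apply] at h
  rw [← h]
  refine Finset.sum_congr rfl fun l _ => ?_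
  rw [δ_eq, map_add, map_add, map_neg, map_neg, ← Module.End.mul_apply, ← pow_succ,
    ← sub_eq_add_neg]
  rw [show k + 1 + (l : ℤ) - 1 = k + l by ring,
    show k + 1 + (l : ℤ) = k + ((l + 1 : ℕ) : ℤ) by push_cast; ring]

/-- Left multiplication by `X` as an invertible operator on coefficient sequences; the sequence
of coefficients of `X^i t` is `(S.shiftX ^ i) t`, for every integer `i`. -/
def shiftX : (ℤ → A) ≃ₗ[F] (ℤ → A) :=
  LinearEquiv.ofLinearMap S.mulX S.mulXInv (LinearMap.ext S.mulX_mulXInv)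
    (LinearMap.ext S.mulXInv_mulX)

theorem shiftX_apply (t : ℤ → A) (k : ℤ) : S.shiftX t k = S.σ (t (k - 1)) + S.δ (t k) := rfl

theorem shiftX_zpow_succ (i : ℤ) (t : ℤ → A) :
    (S.shiftX ^ (i + 1)) t = S.shiftX ((S.shiftX ^ i) t) := by
  rw [add_comm, zpow_add, zpow_one]
  rfl

theorem shiftX_zpow_pred (i : ℤ) (t : ℤ → A) :
    (S.shiftX ^ (i - 1)) t = S.mulXInv ((S.shiftX ^ i) t) := by
  rw [sub_eq_add_neg, add_comm, zpow_add, zpow_neg_one]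
  rfl

theorem VanishBelow.mono {B : Type*} [Zero B] {o o' : ℤ} {s : ℤ → B} (h : VanishBelow o s)
    (ho : o' ≤ o) : VanishBelow o' s := fun k hk => h k (by omega)

theorem vanishBelow_shiftX {o : ℤ} {t : ℤ → A} (h : VanishBelow o t) :
    VanishBelow o (S.shiftX t) := fun k hk => by
  rw [shiftX_apply, h k hk, h (k - 1) (by omega), map_zero, map_zero, add_zero]

theorem vanishBelow_shiftX_pow {o : ℤ} {t : ℤ → A} (h : VanishBelow o t) (i : ℕ) :
    VanishBelow o ((S.shiftX ^ (i : ℤ)) t) ∧ (S.shiftX ^ (i : ℤ)) t o = (S.δ ^ i) (t o) := by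
  induction i with
  | zero => exact ⟨h, rfl⟩
  | succ i ih =>
    rw [Nat.cast_succ, shiftX_zpow_succ]
    refine ⟨S.vanishBelow_shiftX ih.1, ?_⟩
    rw [shiftX_apply, ih.1 (o - 1) (by omega), ih.2, map_zero, zero_add, pow_succ',
      Module.End.mul_apply]

theorem vanishBelow_shiftX_class {o : ℤ} {t : ℤ → A} (h : VanishBelow o t) :
    VanishBelow (o + 1) ((S.shiftX ^ ((nilpotencyClass S.δ : ℕ) : ℤ)) t) := fun k hk => by
  obtain ⟨h1, h2⟩ := S.vanishBelow_shiftX_pow h (nilpotencyClass S.δ)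
  rcases (Int.lt_add_one_iff.mp hk).lt_or_eq with h' | rfl
  · exact h1 k h'
  · rw [h2, δ_pow_class, LinearMap.zero_apply]

theorem vanishBelow_zpow_neg {o : ℤ} {t : ℤ → A} (h : VanishBelow o t) (i : ℕ) :
    VanishBelow (o - i * nilpotencyClass S.δ') ((S.shiftX ^ (-(i : ℤ))) t) := by
  induction i with
  | zero => simpa using h
  | succ i ih =>
    rw [Nat.cast_succ, neg_add, ← sub_eq_add_neg, shiftX_zpow_pred]
    refine (S.vanishBelow_mulXInv ih).mono (le_of_eq ?_)
    ring

/-- The series `X^i t`, for `i` and the order of `t` bounded below, have bounded below order. -/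
theorem exists_vanishBelow (i₀ o : ℤ) : ∃ c : ℤ, ∀ i ≥ i₀, ∀ t : ℤ → A, VanishBelow o t →
    VanishBelow c ((S.shiftX ^ i) t) := by
  refine ⟨o - i₀.natAbs * nilpotencyClass S.δ', fun i hi t ht => ?_⟩
  rcases le_or_gt 0 i with h | h
  · obtain ⟨j, rfl⟩ := Int.eq_ofNat_of_zero_le h
    exact (S.vanishBelow_shiftX_pow ht j).1.mono (by
      have : (0 : ℤ) ≤ i₀.natAbs * nilpotencyClass S.δ' := by positivity
      omega)
  · obtain ⟨j, hj⟩ := Int.eq_ofNat_of_zero_le (by omega : 0 ≤ -i)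
    obtain rfl : i = -(j : ℤ) := by omega
    refine (S.vanishBelow_zpow_neg ht j).mono ?_
    have : (j : ℤ) ≤ i₀.natAbs := by omega
    have := mul_le_mul_of_nonneg_right this (by positivity : (0 : ℤ) ≤ nilpotencyClass S.δ')
    omega

/-- The order of `X^i t` tends to infinity with `i`. -/
theorem exists_vanishBelow_large (N o : ℤ) : ∃ I : ℤ, ∀ i ≥ I, ∀ t : ℤ → A, VanishBelow o t →
    VanishBelow N ((S.shiftX ^ i) t) := by
  have key : ∀ j : ℕ, ∀ i ≥ ((j * nilpotencyClass S.δ : ℕ) : ℤ), ∀ t : ℤ → A, VanishBelow o t →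
      VanishBelow (o + j) ((S.shiftX ^ i) t) := by
    intro j
    induction j with
    | zero =>
      intro i hi t ht
      obtain ⟨k, rfl⟩ := Int.eq_ofNat_of_zero_le (by omega : 0 ≤ i)
      simpa using (S.vanishBelow_shiftX_pow ht k).1
    | succ j ih =>
      intro i hi t ht
      have h := S.vanishBelow_shiftX_class (ih (i - nilpotencyClass S.δ) (by
        push_cast at hi ⊢
        linarith) t ht)
      rw [← LinearEquiv.mul_apply, ← zpow_add] at h
      rw [add_sub_cancel] at h
      exact h.mono (by push_cast; omega)
  refine ⟨((N - o).toNat * nilpotencyClass S.δ : ℕ), fun i hi t ht => ?_⟩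
  exact (key (N - o).toNat i hi t ht).mono (by omega)

/-- The coefficients of the product `(∑ s_i X^i) t = ∑ s_i (X^i t)`, for `s = ∑ s_i X^i` in
`M((X))` and `t` in `A((X;σ,δ))`, where `M` is a right `A`-module. For Laurent series `s` and `t`
each of the sums below has only finitely many nonzero terms. -/
def laurentAct (s : ℤ → M) (t : ℤ → A) (n : ℤ) : M :=
  ∑ᶠ i : ℤ, op ((S.shiftX ^ i) t n) • s i

theorem laurentAct_eq_sum {s : ℤ → M} {t : ℤ → A} {n i₀ I : ℤ} (hs : VanishBelow i₀ s)
    (ht : ∀ i ≥ I, (S.shiftX ^ i) t n = 0) :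
    S.laurentAct s t n = ∑ i ∈ Finset.Ico i₀ I, op ((S.shiftX ^ i) t n) • s i := by
  refine finsum_eq_sum_of_support_subset _ fun i hi => ?_
  rw [Finset.coe_Ico, Set.mem_Ico]
  constructor
  · by_contra h
    exact hi (by simp only [hs i (by omega), smul_zero])
  · by_contra h
    exact hi (by simp only [ht i (by omega), op_zero, zero_smul])

theorem exists_laurentAct_eq_sum (i₀ o N : ℤ) : ∃ I : ℤ, ∀ I' ≥ I, ∀ n < N, ∀ s : ℤ → M,
    VanishBelow i₀ s → ∀ t : ℤ → A, VanishBelow o t →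
    S.laurentAct s t n = ∑ i ∈ Finset.Ico i₀ I', op ((S.shiftX ^ i) t n) • s i := by
  obtain ⟨I, hI⟩ := S.exists_vanishBelow_large N o
  exact ⟨I, fun I' hI' n hn s hs t ht =>
    S.laurentAct_eq_sum hs fun i hi => hI i (by omega) t ht n hn⟩

theorem exists_vanishBelow_laurentAct (i₀ o : ℤ) : ∃ c : ℤ, ∀ s : ℤ → M, VanishBelow i₀ s →
    ∀ t : ℤ → A, VanishBelow o t → VanishBelow c (S.laurentAct s t) := by
  obtain ⟨c, hc⟩ := S.exists_vanishBelow i₀ o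
  refine ⟨c, fun s hs t ht n hn => ?_⟩
  refine (finsum_congr fun i => ?_).trans finsum_zero
  rcases lt_or_ge i i₀ with h | h
  · rw [hs i h, smul_zero]
  · rw [hc i h t ht n hn, op_zero, zero_smul]

theorem laurentAct_add_left {i₀ o : ℤ} {s s' : ℤ → M} {t : ℤ → A} (hs : VanishBelow i₀ s)
    (hs' : VanishBelow i₀ s') (ht : VanishBelow o t) :
    S.laurentAct (s + s') t = S.laurentAct s t + S.laurentAct s' t := by
  ext n
  obtain ⟨I, hI⟩ := S.exists_laurentAct_eq_sum (M := M) i₀ o (n + 1)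
  have H := hI I le_rfl n (by omega)
  rw [Pi.add_apply, H _ hs _ ht, H _ hs' _ ht,
    H _ (fun k hk => by simp [hs k hk, hs' k hk]) _ ht, ← Finset.sum_add_distrib]
  simp

theorem laurentAct_add_right {i₀ o : ℤ} {s : ℤ → M} {t t' : ℤ → A} (hs : VanishBelow i₀ s)
    (ht : VanishBelow o t) (ht' : VanishBelow o t') :
    S.laurentAct s (t + t') = S.laurentAct s t + S.laurentAct s t' := by
  ext n
  obtain ⟨I, hI⟩ := S.exists_laurentAct_eq_sum (M := M) i₀ o (n + 1)
  have H := hI I le_rfl n (by omega) s hs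
  rw [Pi.add_apply, H _ ht, H _ ht', H _ (fun k hk => by simp [ht k hk, ht' k hk]),
    ← Finset.sum_add_distrib]
  simp [add_smul]

theorem laurentAct_zero_left (t : ℤ → A) : S.laurentAct (0 : ℤ → M) t = 0 := by
  ext n
  exact (finsum_congr fun i => by simp).trans finsum_zero

theorem laurentAct_zero_right (s : ℤ → M) : S.laurentAct s 0 = 0 := by
  ext n
  exact (finsum_congr fun i => by simp).trans finsum_zero

theorem shiftX_laurentAct {i₀ o : ℤ} {t r : ℤ → A} (ht : VanishBelow i₀ t)
    (hr : VanishBelow o r) :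
    S.shiftX (S.laurentAct t r) = S.laurentAct (S.shiftX t) r := by
  ext n
  obtain ⟨I, hI⟩ := S.exists_laurentAct_eq_sum (M := A) i₀ o (n + 1)
  obtain ⟨J, hJ⟩ := S.exists_vanishBelow_large (n + 1) o
  set K := max (max I J) i₀
  rw [shiftX_apply, hI K (by omega) (n - 1) (by omega) t ht r hr,
    hI K (by omega) n (by omega) t ht r hr,
    hI (K + 1) (by omega) n (by omega) _ (S.vanishBelow_shiftX ht) r hr]
  have e1 : ∑ i ∈ Finset.Ico i₀ (K + 1), op ((S.shiftX ^ i) r n) • S.shiftX t i =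
      ∑ i ∈ Finset.Ico i₀ (K + 1), S.σ (t (i - 1)) * (S.shiftX ^ i) r n +
      ∑ i ∈ Finset.Ico i₀ (K + 1), S.δ (t i) * (S.shiftX ^ i) r n := by
    rw [← Finset.sum_add_distrib]
    exact Finset.sum_congr rfl fun i _ => by rw [shiftX_apply, op_smul_eq_mul, add_mul]
  have e2 : ∑ i ∈ Finset.Ico i₀ (K + 1), S.δ (t i) * (S.shiftX ^ i) r n =
      ∑ i ∈ Finset.Ico i₀ K, S.δ (t i) * (S.shiftX ^ i) r n := by
    refine (Finset.sum_subset (Finset.Ico_subset_Ico_right (by omega)) fun i hi hi' => ?_).symm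
    rw [Finset.mem_Ico] at hi hi'
    rw [hJ i (by omega) r hr n (by omega), mul_zero]
  have e3 : ∑ i ∈ Finset.Ico i₀ (K + 1), S.σ (t (i - 1)) * (S.shiftX ^ i) r n =
      ∑ i ∈ Finset.Ico i₀ K, S.σ (t i) * (S.shiftX ^ (i + 1)) r n := by
    rw [← Finset.sum_subset (s₁ := Finset.Ico (i₀ + 1) (K + 1))
      (Finset.Ico_subset_Ico_left (by omega)) fun i hi hi' => ?_, ← Finset.sum_Ico_add']
    · simp
    · rw [Finset.mem_Ico] at hi hi'
      rw [ht (i - 1) (by omega), map_zero, zero_mul]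
  rw [e1, e2, e3, map_sum, map_sum, ← Finset.sum_add_distrib, ← Finset.sum_add_distrib]
  refine Finset.sum_congr rfl fun i _ => ?_
  rw [op_smul_eq_mul, op_smul_eq_mul, map_mul, S.δ_mul, shiftX_zpow_succ, shiftX_apply, mul_add]
  abel

theorem shiftX_zpow_laurentAct {i₀ o : ℤ} {t r : ℤ → A} (ht : VanishBelow i₀ t)
    (hr : VanishBelow o r) (i : ℤ) :
    (S.shiftX ^ i) (S.laurentAct t r) = S.laurentAct ((S.shiftX ^ i) t) r := by
  induction i with
  | zero => rfl
  | succ i ih =>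
    rw [shiftX_zpow_succ, shiftX_zpow_succ, ih,
      S.shiftX_laurentAct (S.vanishBelow_shiftX_pow ht i).1 hr]
  | pred i ih =>
    apply S.shiftX.injective
    have h := S.vanishBelow_zpow_neg ht (i + 1)
    rw [Nat.cast_succ, neg_add, ← sub_eq_add_neg] at h
    rw [S.shiftX_laurentAct h hr, ← shiftX_zpow_succ, ← shiftX_zpow_succ, sub_add_cancel, ih]

theorem laurentAct_laurentAct {i₀ j₀ o : ℤ} {s : ℤ → M} {t r : ℤ → A} (hs : VanishBelow i₀ s)
    (ht : VanishBelow j₀ t) (hr : VanishBelow o r) :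
    S.laurentAct (S.laurentAct s t) r = S.laurentAct s (S.laurentAct t r) := by
  ext n
  obtain ⟨c, hc⟩ := S.exists_vanishBelow i₀ j₀
  obtain ⟨c', hc'⟩ := S.exists_vanishBelow_laurentAct (M := M) i₀ j₀
  obtain ⟨c'', hc''⟩ := S.exists_vanishBelow_laurentAct (M := A) j₀ o
  obtain ⟨J, hJ⟩ := S.exists_laurentAct_eq_sum (M := M) (min c c') o (n + 1)
  obtain ⟨J', hJ'⟩ := S.exists_laurentAct_eq_sum (M := A) (min c c') o (n + 1)
  set K := max J J'
  obtain ⟨I, hI⟩ := S.exists_laurentAct_eq_sum (M := M) i₀ j₀ K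
  obtain ⟨I', hI'⟩ := S.exists_laurentAct_eq_sum (M := M) i₀ c'' (n + 1)
  set L := max I I'
  rw [hJ K (by omega) n (by omega) _ ((hc' s hs t ht).mono (by omega)) r hr,
    hI' L (by omega) n (by omega) s hs _ (hc'' t ht r hr)]
  have e1 : ∀ j ∈ Finset.Ico (min c c') K,
      op ((S.shiftX ^ j) r n) • S.laurentAct s t j = ∑ i ∈ Finset.Ico i₀ L,
        op ((S.shiftX ^ i) t j * (S.shiftX ^ j) r n) • s i := by
    intro j hj
    rw [hI L (by omega) j (Finset.mem_Ico.mp hj).2 s hs t ht, Finset.smul_sum]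
    exact Finset.sum_congr rfl fun i _ => by rw [op_mul, mul_smul]
  have e2 : ∀ i ∈ Finset.Ico i₀ L,
      op ((S.shiftX ^ i) (S.laurentAct t r) n) • s i = ∑ j ∈ Finset.Ico (min c c') K,
        op ((S.shiftX ^ i) t j * (S.shiftX ^ j) r n) • s i := by
    intro i hi
    rw [S.shiftX_zpow_laurentAct ht hr, hJ' K (by omega) n (by omega) _
      ((hc i (Finset.mem_Ico.mp hi).1 t ht).mono (by omega)) r hr, Finset.op_sum,
      Finset.sum_smul]
    exact Finset.sum_congr rfl fun j _ => by rw [op_smul_eq_mul]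
  rw [Finset.sum_congr rfl e1, Finset.sum_congr rfl e2, Finset.sum_comm]

theorem shiftX_zpow_one (i : ℤ) : (S.shiftX ^ i) (Pi.single 0 1) = Pi.single i (1 : A) := by
  have key : ∀ i : ℤ, S.shiftX (Pi.single i (1 : A)) = Pi.single (i + 1) 1 := by
    intro i
    ext k
    rw [shiftX_apply]
    have h1 : S.δ ((Pi.single i (1 : A) : ℤ → A) k) = 0 := by
      by_cases h : k = i <;> simp [h, δ_one]
    have h2 : (Pi.single i (1 : A) : ℤ → A) (k - 1) = (Pi.single (i + 1) 1 : ℤ → A) k := by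
      simp only [Pi.single_apply, sub_eq_iff_eq_add]
    rw [h1, h2, add_zero]
    by_cases h : k = i + 1 <;> simp [h]
  induction i with
  | zero => rfl
  | succ i ih => rw [shiftX_zpow_succ, ih, key]
  | pred i ih =>
    apply S.shiftX.injective
    rw [← shiftX_zpow_succ, key, sub_add_cancel, ih]

theorem laurentAct_one (s : ℤ → M) : S.laurentAct s (Pi.single 0 1) = s := by
  ext n
  refine (finsum_eq_single _ n fun i hi => ?_).trans ?_
  · rw [shiftX_zpow_one, Pi.single_eq_of_ne hi.symm, op_zero, zero_smul]
  · rw [shiftX_zpow_one, Pi.single_eq_same, op_one, one_smul]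

theorem one_laurentAct (t : ℤ → A) : S.laurentAct (Pi.single 0 (1 : A)) t = t := by
  ext n
  refine (finsum_eq_single _ 0 fun i hi => ?_).trans ?_
  · rw [Pi.single_eq_of_ne hi, smul_zero]
  · rw [Pi.single_eq_same, op_smul_eq_mul, one_mul]
    rfl

theorem _root_.HahnSeries.exists_vanishBelow {B : Type*} [Zero B] (s : HahnSeries ℤ B) :
    ∃ o : ℤ, VanishBelow o s.coeff :=
  ⟨s.order, fun _ hk => HahnSeries.coeff_eq_zero_of_lt_order hk⟩

theorem _root_.HahnSeries.exists_vanishBelow₂ {B C : Type*} [Zero B] [Zero C]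
    (s : HahnSeries ℤ B) (t : HahnSeries ℤ C) :
    ∃ o : ℤ, VanishBelow o s.coeff ∧ VanishBelow o t.coeff := by
  obtain ⟨o, ho⟩ := s.exists_vanishBelow
  obtain ⟨o', ho'⟩ := t.exists_vanishBelow
  exact ⟨min o o', ho.mono (by omega), ho'.mono (by omega)⟩

/-- The product of a Laurent series in `M((X))` by a skew Laurent series. -/
def laurentMul (s : HahnSeries ℤ M) (t : LaurentSeries A) : HahnSeries ℤ M :=
  HahnSeries.ofSuppBddBelow (S.laurentAct s.coeff t.coeff) <| by
    obtain ⟨i, hi⟩ := s.exists_vanishBelow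
    obtain ⟨o, ho⟩ := t.exists_vanishBelow
    obtain ⟨c, hc⟩ := S.exists_vanishBelow_laurentAct (M := M) i o
    exact ⟨c, fun k hk => not_lt.mp fun h => hk (hc _ hi _ ho k h)⟩

@[simp]
theorem coeff_laurentMul (s : HahnSeries ℤ M) (t : LaurentSeries A) :
    (S.laurentMul s t).coeff = S.laurentAct s.coeff t.coeff := rfl

theorem laurentMul_add_left (s s' : HahnSeries ℤ M) (t : LaurentSeries A) :
    S.laurentMul (s + s') t = S.laurentMul s t + S.laurentMul s' t := by
  obtain ⟨i, hi, hi'⟩ := s.exists_vanishBelow₂ s'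
  obtain ⟨o, ho⟩ := t.exists_vanishBelow
  exact HahnSeries.coeff_inj.1 (S.laurentAct_add_left hi hi' ho)

theorem laurentMul_add_right (s : HahnSeries ℤ M) (t t' : LaurentSeries A) :
    S.laurentMul s (t + t') = S.laurentMul s t + S.laurentMul s t' := by
  obtain ⟨i, hi⟩ := s.exists_vanishBelow
  obtain ⟨o, ho, ho'⟩ := t.exists_vanishBelow₂ t'
  exact HahnSeries.coeff_inj.1 (S.laurentAct_add_right hi ho ho')

theorem zero_laurentMul (t : LaurentSeries A) : S.laurentMul (0 : HahnSeries ℤ M) t = 0 :=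
  HahnSeries.coeff_inj.1 (S.laurentAct_zero_left _)

theorem laurentMul_zero (s : HahnSeries ℤ M) : S.laurentMul s 0 = 0 :=
  HahnSeries.coeff_inj.1 (S.laurentAct_zero_right _)

theorem laurentMul_laurentMul (s : HahnSeries ℤ M) (t r : LaurentSeries A) :
    S.laurentMul (S.laurentMul s t) r = S.laurentMul s (S.laurentMul t r) := by
  obtain ⟨i, hi⟩ := s.exists_vanishBelow
  obtain ⟨j, hj⟩ := t.exists_vanishBelow
  obtain ⟨o, ho⟩ := r.exists_vanishBelow
  exact HahnSeries.coeff_inj.1 (S.laurentAct_laurentAct hi hj ho)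

theorem coeff_single_eq (i : ℤ) (a : A) :
    (HahnSeries.single i a).coeff = (Pi.single i a : ℤ → A) := by
  ext k
  simp [HahnSeries.coeff_single, Pi.single_apply]

theorem laurentMul_one (s : HahnSeries ℤ M) :
    S.laurentMul s (HahnSeries.single 0 (1 : A)) = s :=
  HahnSeries.coeff_inj.1 <| by rw [coeff_laurentMul, coeff_single_eq, laurentAct_one]

theorem one_laurentMul (t : LaurentSeries A) :
    S.laurentMul (HahnSeries.single 0 (1 : A)) t = t :=
  HahnSeries.coeff_inj.1 <| by rw [coeff_laurentMul, coeff_single_eq, one_laurentAct]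

end Laurent

/-- The underlying left `A`-module `A((X))` of the skew Laurent series ring `A((X;σ,δ))`. -/
@[ext]
structure SkewLaurent {F A : Type*} [Field F] [Ring A] [Algebra F A]
    (S : LeftSkewDerivation F A) where
  series : LaurentSeries A

namespace SkewLaurent

variable {F A : Type*} [Field F] [Ring A] [Algebra F A] {S : LeftSkewDerivation F A}
variable {M : Type*} [AddCommGroup M] [Module Aᵐᵒᵖ M]

/-- A skew Laurent series is determined by its coefficients. -/
def seriesEquiv : SkewLaurent S ≃ LaurentSeries A := ⟨series, mk, fun _ => rfl, fun _ => rfl⟩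

instance : AddCommGroup (SkewLaurent S) := seriesEquiv.addCommGroup

@[simp] theorem series_zero : (0 : SkewLaurent S).series = 0 := rfl
@[simp] theorem series_add (s t : SkewLaurent S) : (s + t).series = s.series + t.series := rfl

instance : One (SkewLaurent S) := ⟨⟨HahnSeries.single 0 1⟩⟩

theorem series_one : (1 : SkewLaurent S).series = HahnSeries.single 0 1 := rfl

variable [S.IsBiNilpotent]

instance : Mul (SkewLaurent S) := ⟨fun s t => ⟨S.laurentMul s.series t.series⟩⟩

theorem series_mul (s t : SkewLaurent S) : (s * t).series = S.laurentMul s.series t.series := rfl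

/-- The skew Laurent series ring `A((X;σ,δ))`. -/
instance : Ring (SkewLaurent S) where
  __ := (inferInstance : AddCommGroup (SkewLaurent S))
  left_distrib f g h := SkewLaurent.ext (S.laurentMul_add_right f.series g.series h.series)
  right_distrib f g h := SkewLaurent.ext (S.laurentMul_add_left f.series g.series h.series)
  zero_mul f := SkewLaurent.ext (S.zero_laurentMul f.series)
  mul_zero f := SkewLaurent.ext (S.laurentMul_zero f.series)
  mul_assoc f g h := SkewLaurent.ext (S.laurentMul_laurentMul f.series g.series h.series)
  one_mul f := SkewLaurent.ext (S.one_laurentMul f.series)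
  mul_one f := SkewLaurent.ext (S.laurentMul_one f.series)

/-- The monomial `a X^i`, for an integer `i`. -/
def monomial (i : ℤ) (a : A) : SkewLaurent S := ⟨HahnSeries.single i a⟩

/-- The relation `X a = σ(a) X + δ(a)`. -/
theorem X_mul (a : A) : (monomial 1 1 * monomial 0 a : SkewLaurent S) =
    monomial 1 (S.σ a) + monomial 0 (S.δ a) := by
  refine SkewLaurent.ext (HahnSeries.coeff_inj.1 ?_)
  simp only [series_mul, series_add, coeff_laurentMul, monomial, coeff_single_eq,
    HahnSeries.coeff_add']
  ext n
  refine (finsum_eq_single _ 1 fun i hi => by rw [Pi.single_eq_of_ne hi, smul_zero]).trans ?_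
  rw [Pi.single_eq_same, op_smul_eq_mul, one_mul, zpow_one, shiftX_apply]
  by_cases h0 : n = 0
  · subst h0; simp
  · by_cases h1 : n = 1
    · subst h1; simp
    · simp [h0, h1, sub_eq_zero]

/-- The relation `X⁻¹ a = ∑_l σ'δ'^l(a) X^(-1-l)`, with `σ' = σ⁻¹`. -/
theorem X_inv_mul (a : A) : (monomial (-1) 1 * monomial 0 a : SkewLaurent S) =
    ∑ l ∈ Finset.range (nilpotencyClass S.δ'), monomial (-1 - l) (S.σ.symm ((S.δ' ^ l) a)) := by
  refine SkewLaurent.ext (HahnSeries.coeff_inj.1 ?_)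
  have hs : ∀ (s : Finset ℕ) (f : ℕ → SkewLaurent S) (n : ℤ),
      (∑ l ∈ s, f l).series.coeff n = ∑ l ∈ s, (f l).series.coeff n := by
    intro s f n
    induction s using Finset.cons_induction with
    | empty => simp
    | cons l s hl ih =>
      rw [Finset.sum_cons, Finset.sum_cons, series_add, HahnSeries.coeff_add', Pi.add_apply, ih]
  simp only [series_mul, coeff_laurentMul]
  ext n
  rw [hs]
  simp only [monomial, coeff_single_eq]
  refine (finsum_eq_single _ (-1) fun i hi => by rw [Pi.single_eq_of_ne hi, smul_zero]).trans ?_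
  rw [Pi.single_eq_same, op_smul_eq_mul, one_mul, zpow_neg_one]
  change ∑ l ∈ Finset.range (nilpotencyClass S.δ'),
    S.σ.symm ((S.δ' ^ l) ((Pi.single 0 a : ℤ → A) (n + 1 + l))) = _
  refine Finset.sum_congr rfl fun l _ => ?_
  by_cases h : n + 1 + l = 0
  · obtain rfl : n = -1 - l := by omega
    rw [h, Pi.single_eq_same, Pi.single_eq_same]
  · rw [Pi.single_eq_of_ne h, Pi.single_eq_of_ne (by omega), map_zero, map_zero]

/-- For a right `A`-module `M`, the Laurent series `M((X))` are a right `A((X;σ,δ))`-module. -/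
instance [Module F M] : Module (SkewLaurent S)ᵐᵒᵖ (HahnModule ℤ F M) where
  smul t s := HahnModule.of F (S.laurentMul ((HahnModule.of F).symm s) t.unop.series)
  one_smul s := S.laurentMul_one ((HahnModule.of F).symm s)
  mul_smul _ _ s := (S.laurentMul_laurentMul ((HahnModule.of F).symm s) _ _).symm
  smul_zero t := S.zero_laurentMul (M := M) t.unop.series
  smul_add _ s _ := S.laurentMul_add_left ((HahnModule.of F).symm s) _ _
  add_smul _ _ s := S.laurentMul_add_right ((HahnModule.of F).symm s) _ _
  zero_smul s := S.laurentMul_zero ((HahnModule.of F).symm s)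

theorem op_smul_def [Module F M] (t : SkewLaurent S) (s : HahnModule ℤ F M) :
    op t • s = HahnModule.of F (S.laurentMul ((HahnModule.of F).symm s) t.series) := rfl

/-- The rule `(∑ s_i X^i) X^j = ∑ s_i X^(i+j)` in `M((X))`. -/
theorem coeff_op_monomial_smul [Module F M] (j : ℤ) (s : HahnModule ℤ F M) (n : ℤ) :
    ((HahnModule.of F).symm (op (monomial j 1 : SkewLaurent S) • s)).coeff n =
      ((HahnModule.of F).symm s).coeff (n - j) := by
  rw [op_smul_def, Equiv.symm_apply_apply, coeff_laurentMul, monomial, coeff_single_eq,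
    ← S.shiftX_zpow_one]
  refine (finsum_eq_single _ (n - j) fun i hi => ?_).trans ?_ <;>
    rw [← LinearEquiv.mul_apply, ← zpow_add, S.shiftX_zpow_one]
  · rw [Pi.single_eq_of_ne (by omega), op_zero, zero_smul]
  · rw [sub_add_cancel, Pi.single_eq_same, op_one, one_smul]

end SkewLaurent

end LeftSkewDerivation

/-! ### Convolutional codes -/

/-- The inclusion of the polynomials `V[X]` in the Laurent series `V((X))`. -/
def PolynomialModule.toLaurent {F V : Type*} [Field F] [AddCommGroup V] [Module F V]
    (p : PolynomialModule F V) : HahnModule ℤ F V :=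
  HahnModule.of F <| HahnSeries.ofSuppBddBelow
    (fun k : ℤ => if 0 ≤ k then p.coeff k.toNat else 0)
    ⟨0, fun _ hk => by_contra fun h => hk (if_neg h)⟩

/-- A subset `D` of `F^n((X))` is a convolutional code of rate `k/n` if it is a `k`-dimensional
`F((X))`-vector subspace of `F^n((X))` with a basis consisting of polynomial vectors. -/
def IsConvolutionalCode {F : Type*} [Field F] {n : ℕ} (k : ℕ)
    (D : Set (HahnModule ℤ F (Fin n → F))) : Prop :=
  ∃ (W : Submodule (LaurentSeries F) (HahnModule ℤ F (Fin n → F)))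
    (b : Module.Basis (Fin k) (LaurentSeries F) W),
    (W : Set (HahnModule ℤ F (Fin n → F))) = D ∧
      ∀ i, ∃ p : PolynomialModule F (Fin n → F), p.toLaurent = b i

/-- A subset `D` of `F^n((X))` is a `(σ,δ,A)`-cyclic convolutional code of rate `k/n` if it is a
convolutional code of rate `k/n` and a right `A`-submodule of `F^n((X))`, where `A` acts through
the inclusion of `A` in `A((X;σ,δ))` as the constant series. -/
def IsCyclicConvolutionalCode {F A : Type*} [Field F] [Ring A] [Algebra F A]
    (S : LeftSkewDerivation F A) [S.IsBiNilpotent] {n : ℕ} [Module Aᵐᵒᵖ (Fin n → F)] (k : ℕ)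
    (D : Set (HahnModule ℤ F (Fin n → F))) : Prop :=
  IsConvolutionalCode k D ∧
    ∀ s ∈ D, ∀ a : A, op (LeftSkewDerivation.SkewLaurent.monomial 0 a : S.SkewLaurent) • s ∈ D

/-- A subset `C` of `F^n[X]` is an `F[X]`-direct summand of rank `k` of `F^n[X]`. -/
def IsDirectSummandOfRank {F : Type*} [Field F] {n : ℕ} (k : ℕ)
    (C : Set (PolynomialModule F (Fin n → F))) : Prop :=
  ∃ N N' : Submodule (Polynomial F) (PolynomialModule F (Fin n → F)),
    (N : Set (PolynomialModule F (Fin n → F))) = C ∧ IsCompl N N' ∧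
      Module.finrank (Polynomial F) N = k

end

/-!
A convolutional code `D` is the `F((X))`-span of its polynomial vectors, so `D` is recovered from
`N = D ∩ F^n[X]`. Since `D` is closed under division by nonzero polynomials, `F^n[X] / N` is
torsion-free, hence free, and `N` is a direct summand (`exists_isCompl_comapLaurent`). Conversely,
for a decomposition `F^n[X] = N ⊕ N'` the spans of `N` and `N'` over `F((X))` generate
`F^n((X))`, so counting dimensions shows that they have dimensions `rank N` and `rank N'` and are
independent (`laurentSpan_of_isCompl`); hence the span of `N` meets `F^n[X]` in `N` only
(`comapLaurent_laurentSpan`).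

It remains to match the module structures. The field `F((X))` lies in `A((X;σ,δ))`, as `X` commutes
with `F`, and the right action of `A((X;σ,δ))` on `F^n((X))` restricts to the scalar action of
`F((X))` (`op_ofLaurent_smul`). Because `A` has a finite basis `e_r` over `F`, every skew Laurent
series is `t = ∑ e_r t_r` with `t_r` in `F((X))`, so that `s t = ∑ t_r (s e_r)`
(`op_smul_eq_sum`). Therefore an `F((X))`-subspace that is stable under `A` is stable under
`A((X;σ,δ))`, in particular under `A[X;σ,δ]`. In the other direction, let `N` be stable under `A`
and `s = l p` with `l ∈ F((X))` and `p ∈ N`; then `s a = p (l a) = ∑ t_r (p e_r)` with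
`l a = ∑ e_r t_r` lies in the span of `N` (`op_smul_mem_laurentSpan`).
-/

/-! ### Polynomial vectors inside Laurent series -/

namespace PolynomialModule

open Polynomial

variable {F V : Type*} [Field F] [AddCommGroup V] [Module F V]

theorem coeff_toLaurent (p : PolynomialModule F V) (k : ℤ) :
    ((HahnModule.of F).symm p.toLaurent).coeff k = if 0 ≤ k then p.coeff k.toNat else 0 := rfl

@[simp]
theorem toLaurent_zero : (0 : PolynomialModule F V).toLaurent = 0 := by
  ext k
  simp [coeff_toLaurent]

@[simp]
theorem toLaurent_add (p q : PolynomialModule F V) :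
    (p + q).toLaurent = p.toLaurent + q.toLaurent := by
  ext k
  simp only [HahnModule.of_symm_add, HahnSeries.coeff_add, coeff_toLaurent, coeff_add,
    Finsupp.add_apply]
  split_ifs <;> simp

theorem toLaurent_injective :
    Function.Injective (toLaurent : PolynomialModule F V → HahnModule ℤ F V) := by
  intro p q h
  ext i
  have := congrArg (fun s => ((HahnModule.of F).symm s).coeff (i : ℤ)) h
  simpa [coeff_toLaurent] using this

theorem toLaurent_single (i : ℕ) (v : V) :
    (single F i v).toLaurent = HahnModule.of F (HahnSeries.single (i : ℤ) v) := by
  classical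
  ext k
  rw [coeff_toLaurent, coeff_single, Equiv.symm_apply_apply, HahnSeries.coeff_single,
    Finsupp.single_apply]
  split_ifs <;> first | rfl | omega

theorem algebraMap_laurentSeries_monomial (i : ℕ) (r : F) :
    algebraMap F[X] (LaurentSeries F) (monomial i r) = HahnSeries.single (i : ℤ) r := by
  rw [HahnSeries.algebraMap_apply']
  ext k
  rw [PowerSeries.algebraMap_apply', PowerSeries.coeff_coe, PowerSeries.coeff_map,
    Polynomial.coeff_coe, Polynomial.coeff_monomial, HahnSeries.coeff_single]
  split_ifs <;> first | omega | simp

theorem toLaurent_smul (q : F[X]) (p : PolynomialModule F V) :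
    (q • p).toLaurent = algebraMap F[X] (LaurentSeries F) q • p.toLaurent := by
  induction p using PolynomialModule.induction_linear with
  | zero => simp
  | add p p' h h' => simp only [smul_add, toLaurent_add, h, h']
  | single j v =>
    induction q using Polynomial.induction_on' with
    | add q q' h h' => simp only [add_smul, toLaurent_add, h, h', map_add]
    | monomial i r =>
      rw [monomial_smul_single, algebraMap_laurentSeries_monomial, toLaurent_single,
        toLaurent_single]
      ext k
      have := HahnModule.coeff_single_smul_vadd (r := r) (b := (i : ℤ)) (a := k - i)
        (x := HahnModule.of F (HahnSeries.single (j : ℤ) v))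
      rw [vadd_eq_add, add_sub_cancel] at this
      rw [this]
      simp only [Equiv.symm_apply_apply, HahnSeries.coeff_single]
      by_cases h : k = i + j
      · subst h; simp
      · rw [if_neg (by push_cast; omega), if_neg (by omega), smul_zero]

/-- The inclusion of `V[X]` in `V((X))`, as a map semilinear along `F[X] → F((X))`. -/
noncomputable def toLaurentHom :
    PolynomialModule F V →ₛₗ[algebraMap F[X] (LaurentSeries F)] HahnModule ℤ F V where
  toFun := toLaurent
  map_add' := toLaurent_add
  map_smul' := toLaurent_smul

/-- The `F((X))`-subspace of `V((X))` generated by the polynomial vectors in `N`. -/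
noncomputable def laurentSpan (N : Submodule F[X] (PolynomialModule F V)) :
    Submodule (LaurentSeries F) (HahnModule ℤ F V) :=
  Submodule.span _ (toLaurent '' N)

theorem toLaurent_mem_laurentSpan {N : Submodule F[X] (PolynomialModule F V)}
    {p : PolynomialModule F V} (hp : p ∈ N) : p.toLaurent ∈ laurentSpan N :=
  Submodule.subset_span ⟨p, hp, rfl⟩

/-- The `F[X]`-module of the polynomial vectors in a subspace of `V((X))`. -/
noncomputable def comapLaurent (W : Submodule (LaurentSeries F) (HahnModule ℤ F V)) :
    Submodule F[X] (PolynomialModule F V) :=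
  W.comap toLaurentHom

theorem mem_comapLaurent {W : Submodule (LaurentSeries F) (HahnModule ℤ F V)}
    {p : PolynomialModule F V} : p ∈ comapLaurent W ↔ p.toLaurent ∈ W := Iff.rfl

theorem laurentSpan_eq_span_range {N : Submodule F[X] (PolynomialModule F V)} {ι : Type*}
    (b : Module.Basis ι F[X] N) :
    laurentSpan N =
      Submodule.span _ (Set.range fun i => (b i : PolynomialModule F V).toLaurent) := by
  apply le_antisymm
  · refine Submodule.span_le.2 ?_
    rintro _ ⟨p, hp, rfl⟩
    have h : p ∈ Submodule.span F[X] (Set.range fun i => (b i : PolynomialModule F V)) := by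
      have := Submodule.mem_map_of_mem (f := N.subtype) (b.mem_span ⟨p, hp⟩)
      rwa [Submodule.map_span, ← Set.range_comp] at this
    have h2 : Submodule.span F[X] (Set.range fun i => (b i : PolynomialModule F V)) ≤
        (Submodule.span (LaurentSeries F)
          (Set.range fun i => (b i : PolynomialModule F V).toLaurent)).comap toLaurentHom := by
      refine Submodule.span_le.2 ?_
      rintro _ ⟨i, rfl⟩
      exact Submodule.subset_span ⟨i, rfl⟩
    exact h2 h
  · refine Submodule.span_mono ?_
    rintro _ ⟨i, rfl⟩
    exact ⟨b i, (b i).2, rfl⟩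

/-- A subspace with a basis of polynomial vectors is spanned by its polynomial vectors. -/
theorem laurentSpan_comapLaurent {W : Submodule (LaurentSeries F) (HahnModule ℤ F V)} {ι : Type*}
    (b : Module.Basis ι (LaurentSeries F) W)
    (hb : ∀ i, ∃ p : PolynomialModule F V, p.toLaurent = b i) :
    laurentSpan (comapLaurent W) = W := by
  refine le_antisymm (Submodule.span_le.2 ?_) fun s hs => ?_
  · rintro _ ⟨p, hp, rfl⟩
    exact hp
  · have := Submodule.mem_map_of_mem (f := W.subtype) (b.mem_span ⟨s, hs⟩)
    rw [Submodule.map_span, ← Set.range_comp] at this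
    refine Submodule.span_le.2 ?_ this
    rintro _ ⟨i, rfl⟩
    obtain ⟨p, hp⟩ := hb i
    change (b i : HahnModule ℤ F V) ∈ _
    rw [← hp]
    refine toLaurent_mem_laurentSpan (mem_comapLaurent.2 ?_)
    rw [hp]
    exact (b i).2

theorem toLaurent_mem_sup {N N' : Submodule F[X] (PolynomialModule F V)} (h : N ⊔ N' = ⊤)
    (p : PolynomialModule F V) : p.toLaurent ∈ laurentSpan N ⊔ laurentSpan N' := by
  obtain ⟨x, hx, y, hy, rfl⟩ := Submodule.mem_sup.1 (h ▸ Submodule.mem_top : p ∈ N ⊔ N')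
  rw [toLaurent_add]
  exact Submodule.add_mem_sup (toLaurent_mem_laurentSpan hx) (toLaurent_mem_laurentSpan hy)

variable [Module.Finite F V]

instance : Module.Finite F[X] (PolynomialModule F V) :=
  Module.Finite.equiv (polynomialTensorProductLEquivPolynomialModule F V)

instance : Module.Free F[X] (PolynomialModule F V) :=
  Module.Free.of_equiv (polynomialTensorProductLEquivPolynomialModule F V)

theorem finrank_eq_finrank :
    Module.finrank F[X] (PolynomialModule F V) = Module.finrank F V := by
  rw [← (polynomialTensorProductLEquivPolynomialModule F V).finrank_eq, Module.finrank_baseChange]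

theorem finrank_laurentSpan_le (N : Submodule F[X] (PolynomialModule F V)) :
    Module.finrank (LaurentSeries F) (laurentSpan N) ≤ Module.finrank F[X] N := by
  rw [laurentSpan_eq_span_range (Module.finBasis F[X] N)]
  exact (finrank_range_le_card _).trans (by simp)

end PolynomialModule

/-! ### The `F((X))`-vector space `F^n((X))` -/

namespace HahnModule

variable {F V : Type*} [Field F] [AddCommGroup V] [Module F V]

/-- The coefficients of a product `l s` with `l ∈ F((X))` and `s ∈ V((X))`, as a sum over all
integers; this is the shape of the sum that defines `laurentAct`. -/
theorem coeff_smul_eq_finsum (l : LaurentSeries F) (s : HahnModule ℤ F V) (n : ℤ) :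
    ((of F).symm (l • s)).coeff n = ∑ᶠ i : ℤ, l.coeff (n - i) • ((of F).symm s).coeff i := by
  classical
  rw [coeff_smul]
  set T := Finset.VAddAntidiagonal n (Set.VAddAntidiagonal.finite_of_isPWO l.isPWO_support
    ((of F).symm s).isPWO_support n)
  have hT : ∀ x ∈ T, x.1 = n - x.2 := fun x hx =>
    eq_sub_of_add_eq ((Finset.mem_vaddAntidiagonal _ _).1 hx).2.2
  have hinj : Set.InjOn Prod.snd (T : Set (ℤ × ℤ)) := fun x hx y hy hxy =>
    Prod.ext (by rw [hT x hx, hT y hy, hxy]) hxy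
  rw [finsum_eq_sum_of_support_subset (s := T.image Prod.snd), Finset.sum_image hinj]
  · exact Finset.sum_congr rfl fun x hx => by rw [hT x hx]
  · intro i hi
    rw [Function.mem_support, smul_ne_zero_iff] at hi
    exact Finset.mem_coe.2 (Finset.mem_image.2 ⟨(n - i, i),
      (Finset.mem_vaddAntidiagonal _ _).2 ⟨hi.1, hi.2, sub_add_cancel n i⟩, rfl⟩)

theorem coeff_smul_of_single (l : LaurentSeries F) (v : V) (k : ℤ) :
    ((of F).symm (l • (of F (HahnSeries.single (0 : ℤ) v) : HahnModule ℤ F V))).coeff k =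
      l.coeff k • v := by
  rw [coeff_smul_eq_finsum, finsum_eq_single _ 0 fun i hi => by
    rw [Equiv.symm_apply_apply, HahnSeries.coeff_single_of_ne hi, smul_zero]]
  rw [Equiv.symm_apply_apply, HahnSeries.coeff_single_same, sub_zero]

theorem coeff_sum {ι : Type*} (t : Finset ι) (f : ι → HahnModule ℤ F V) (k : ℤ) :
    ((of F).symm (∑ i ∈ t, f i)).coeff k = ∑ i ∈ t, ((of F).symm (f i)).coeff k :=
  map_sum (AddMonoidHom.mk' (fun s : HahnModule ℤ F V => ((of F).symm s).coeff k)
    fun _ _ => rfl) f t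

/-- The isomorphism of `F((X))`-vector spaces from `F((X))^n` to `F^n((X))`, sending `g` to
`∑ g_i e_i` with `e_i` the constant standard basis vectors. -/
noncomputable def piEquiv (F : Type*) [Field F] (n : ℕ) :
    (Fin n → LaurentSeries F) ≃ₗ[LaurentSeries F] HahnModule ℤ F (Fin n → F) :=
  LinearEquiv.ofBijective (Fintype.linearCombination (LaurentSeries F) fun i =>
    (of F (HahnSeries.single (0 : ℤ) (Pi.single i 1)) : HahnModule ℤ F (Fin n → F))) <| by
  -- The `k`-th coefficient of `∑ g_j e_j` is the vector of the `k`-th coefficients of the `g_j`.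
  have key : ∀ (g : Fin n → LaurentSeries F) (k : ℤ) (j : Fin n),
      ((of F).symm (Fintype.linearCombination (LaurentSeries F) (fun i =>
        (of F (HahnSeries.single (0 : ℤ) (Pi.single i 1)) : HahnModule ℤ F (Fin n → F)))
          g)).coeff k j = (g j).coeff k := by
    intro g k j
    rw [Fintype.linearCombination_apply, coeff_sum, Finset.sum_apply, Finset.sum_eq_single j]
    · rw [coeff_smul_of_single]; simp
    · intro i _ hij
      rw [coeff_smul_of_single]
      simp [Pi.single_eq_of_ne hij.symm]
    · simp
  constructor
  · intro g g' h
    ext j k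
    rw [← key g, h, key]
  · intro s
    refine ⟨fun j => ((of F).symm s).map (Pi.evalAddMonoidHom _ j : (Fin n → F) →+ F), ?_⟩
    ext k j
    rw [key]
    rfl

instance (F : Type*) [Field F] (n : ℕ) :
    Module.Finite (LaurentSeries F) (HahnModule ℤ F (Fin n → F)) :=
  Module.Finite.equiv (piEquiv F n)

theorem finrank_eq (F : Type*) [Field F] (n : ℕ) :
    Module.finrank (LaurentSeries F) (HahnModule ℤ F (Fin n → F)) = n := by
  rw [← (piEquiv F n).finrank_eq, Module.finrank_fin_fun]

end HahnModule

/-! ### Direct summands of `F^n[X]` and subspaces of `F^n((X))` -/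

namespace PolynomialModule

open Polynomial

variable {F : Type*} [Field F] {n : ℕ}

open HahnModule

theorem laurentSpan_sup_eq_top {N N' : Submodule F[X] (PolynomialModule F (Fin n → F))}
    (h : N ⊔ N' = ⊤) : laurentSpan N ⊔ laurentSpan N' = ⊤ := by
  refine eq_top_iff.2 fun s _ => ?_
  obtain ⟨g, rfl⟩ := (piEquiv F n).surjective s
  change Fintype.linearCombination (LaurentSeries F) _ g ∈ _
  rw [Fintype.linearCombination_apply]
  refine Submodule.sum_mem _ fun i _ => Submodule.smul_mem _ _ ?_
  have := toLaurent_mem_sup h (single F 0 (Pi.single i 1))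
  rwa [toLaurent_single] at this

/-- Passing from `F[X]` to `F((X))` keeps the rank of a direct summand, and keeps complements
independent. -/
theorem laurentSpan_of_isCompl {N N' : Submodule F[X] (PolynomialModule F (Fin n → F))}
    (h : IsCompl N N') : Module.finrank (LaurentSeries F) (laurentSpan N) = Module.finrank F[X] N ∧
      Disjoint (laurentSpan N) (laurentSpan N') := by
  -- The dimensions of the two spans are at most the ranks of `N` and `N'`, which add up to `n`,
  -- while the spans together generate a space of dimension `n`.
  have h1 := Submodule.finrank_sup_add_finrank_inf_eq (laurentSpan N) (laurentSpan N')
  rw [laurentSpan_sup_eq_top h.sup_eq_top, finrank_top, HahnModule.finrank_eq] at h1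
  have h2 := finrank_laurentSpan_le N
  have h3 := finrank_laurentSpan_le N'
  have h4 : Module.finrank F[X] N + Module.finrank F[X] N' = n := by
    rw [← Module.finrank_prod, (Submodule.prodEquivOfIsCompl N N' h).finrank_eq,
      finrank_eq_finrank, Module.finrank_fin_fun]
  refine ⟨by omega, ?_⟩
  rw [disjoint_iff, ← Submodule.finrank_eq_zero (R := LaurentSeries F)]
  omega

/-- A direct summand contains all the polynomial vectors in the subspace it generates. -/
theorem comapLaurent_laurentSpan {N N' : Submodule F[X] (PolynomialModule F (Fin n → F))}
    (h : IsCompl N N') : comapLaurent (laurentSpan N) = N := by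
  refine le_antisymm (fun p hp => ?_) fun p hp => toLaurent_mem_laurentSpan hp
  obtain ⟨x, hx, y, hy, rfl⟩ := Submodule.mem_sup.1 (h.sup_eq_top ▸ Submodule.mem_top : p ∈ N ⊔ N')
  rw [mem_comapLaurent, toLaurent_add,
    Submodule.add_mem_iff_right _ (toLaurent_mem_laurentSpan hx)] at hp
  have := Submodule.disjoint_def.1 (laurentSpan_of_isCompl h).2 _ hp (toLaurent_mem_laurentSpan hy)
  rw [← toLaurent_zero] at this
  rwa [toLaurent_injective this, add_zero]

/-- The polynomial vectors in a subspace `W` form a direct summand: as `W` is closed under division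
by nonzero polynomials, the quotient is torsion-free, hence free over the principal ideal domain
`F[X]`, and the projection onto it splits. -/
theorem exists_isCompl_comapLaurent
    (W : Submodule (LaurentSeries F) (HahnModule ℤ F (Fin n → F))) :
    ∃ N', IsCompl (comapLaurent W) N' := by
  have : Module.IsTorsionFree F[X] (PolynomialModule F (Fin n → F) ⧸ comapLaurent W) := by
    refine .mk fun q hq => isSMulRegular_iff_right_eq_zero_of_smul.2 fun x hx => ?_
    obtain ⟨p, rfl⟩ := Submodule.Quotient.mk_surjective _ x
    rw [← Submodule.Quotient.mk_smul, Submodule.Quotient.mk_eq_zero, mem_comapLaurent,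
      toLaurent_smul] at hx
    refine (Submodule.Quotient.mk_eq_zero _).2 ((W.smul_mem_iff ?_).1 hx)
    exact (map_ne_zero_iff _
      (FaithfulSMul.algebraMap_injective F[X] (LaurentSeries F))).2 hq.ne_zero
  obtain ⟨s, hs⟩ := Module.projective_lifting_property (comapLaurent W).mkQ LinearMap.id
    (comapLaurent W).mkQ_surjective
  have hs' : ∀ x, (comapLaurent W).mkQ (s x) = x := LinearMap.congr_fun hs
  refine ⟨LinearMap.range s, ?_, ?_⟩
  · rw [Submodule.disjoint_def]
    rintro _ hx ⟨y, rfl⟩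
    rw [← hs' y, Submodule.mkQ_apply, (Submodule.Quotient.mk_eq_zero _).2 hx, map_zero]
  · rw [codisjoint_iff, eq_top_iff]
    intro x _
    refine Submodule.mem_sup.2 ⟨x - s ((comapLaurent W).mkQ x), ?_, s ((comapLaurent W).mkQ x),
      ⟨_, rfl⟩, sub_add_cancel _ _⟩
    rw [← Submodule.Quotient.mk_eq_zero, ← Submodule.mkQ_apply, map_sub, hs', sub_self]

end PolynomialModule

/-! ### The skew polynomial ring inside the skew Laurent series ring -/

namespace LeftSkewDerivation

section Comparison

variable {F A : Type*} [Field F] [Ring A] [Algebra F A] (S : LeftSkewDerivation F A)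
variable {M : Type*} [AddCommGroup M]

/-- Extension of a coefficient sequence indexed by `ℕ` to one indexed by `ℤ`, by zero. -/
noncomputable def extendInt : (ℕ →₀ M) →+ (ℤ → M) where
  toFun f k := if 0 ≤ k then f k.toNat else 0
  map_zero' := by ext; simp
  map_add' f g := by
    ext k
    simp only [Pi.add_apply, Finsupp.add_apply]
    split_ifs <;> simp

theorem extendInt_apply (f : ℕ →₀ M) (k : ℤ) :
    extendInt f k = if 0 ≤ k then f k.toNat else 0 := rfl

theorem extendInt_single (j : ℕ) (m : M) :
    extendInt (Finsupp.single j m) = Pi.single (j : ℤ) m := by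
  classical
  ext k
  rw [extendInt_apply, Finsupp.single_apply, Pi.single_apply]
  split_ifs <;> first | rfl | omega

theorem vanishBelow_extendInt (f : ℕ →₀ M) : VanishBelow 0 (extendInt f) :=
  fun _ hk => if_neg (not_le.2 hk)

theorem polyCoeffMul_apply [Module Aᵐᵒᵖ M] (m : M) (f : ℕ →₀ A) (j : ℕ) :
    polyCoeffMul m f j = op (f j) • m := by
  classical
  induction f using Finsupp.induction_linear with
  | zero => simp
  | add f g hf hg => simp [hf, hg, add_smul]
  | single i a =>
    rw [polyCoeffMul_single, Finsupp.single_apply, Finsupp.single_apply]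
    split_ifs <;> simp

variable [S.IsBiNilpotent]

theorem shiftX_extendInt (f : ℕ →₀ A) : S.shiftX (extendInt f) = extendInt (S.polyX f) := by
  induction f using Finsupp.induction_linear with
  | zero => simp
  | add f g hf hg => simp only [map_add, hf, hg]
  | single j a =>
    rw [polyX_single, map_add, extendInt_single, extendInt_single, extendInt_single]
    ext k
    rw [shiftX_apply, Pi.add_apply, Pi.single_apply, Pi.single_apply, Pi.single_apply,
      Pi.single_apply]
    congr 1
    · split_ifs <;> first | rfl | exact map_zero _ | omega
    · split_ifs <;> first | rfl | exact map_zero _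

theorem shiftX_pow_extendInt (i : ℕ) (f : ℕ →₀ A) :
    (S.shiftX ^ (i : ℤ)) (extendInt f) = extendInt ((S.polyX ^ i) f) := by
  induction i with
  | zero => rfl
  | succ i ih =>
    rw [Nat.cast_succ, shiftX_zpow_succ, ih, shiftX_extendInt, pow_succ']
    rfl

/-- The products of `M[X]` with `A[X;σ,δ]` and of `M((X))` with `A((X;σ,δ))` agree on
polynomials. -/
theorem laurentAct_extendInt [Module Aᵐᵒᵖ M] (p : ℕ →₀ M) (f : ℕ →₀ A) :
    S.laurentAct (extendInt p) (extendInt f) = extendInt (S.polyAct p f) := by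
  induction p using Finsupp.induction_linear with
  | zero => simp [laurentAct_zero_left]
  | add p q hp hq =>
    rw [map_add, S.laurentAct_add_left (vanishBelow_extendInt p) (vanishBelow_extendInt q)
      (vanishBelow_extendInt f), hp, hq, map_add, AddMonoidHom.add_apply, map_add]
  | single i m =>
    ext n
    rw [extendInt_single, polyAct_single]
    refine (finsum_eq_single _ (i : ℤ) fun j hj => by
      rw [Pi.single_eq_of_ne hj, smul_zero]).trans ?_
    rw [Pi.single_eq_same, shiftX_pow_extendInt, extendInt_apply, extendInt_apply,
      polyCoeffMul_apply]
    split_ifs <;> simp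

/-- On sequences with values in `F`, multiplication by `X^i` is the shift by `i`. -/
theorem shiftX_zpow_algebraMap (i : ℤ) (t : ℤ → F) :
    (S.shiftX ^ i) (fun k => algebraMap F A (t k)) = fun k => algebraMap F A (t (k - i)) := by
  have hδ : ∀ c : F, S.δ (algebraMap F A c) = 0 := fun c => by
    rw [Algebra.algebraMap_eq_smul_one, map_smul, δ_one, smul_zero]
  have key : ∀ t : ℤ → F, S.shiftX (fun k => algebraMap F A (t k)) =
      fun k => algebraMap F A (t (k - 1)) := fun t => by
    ext k
    rw [shiftX_apply, hδ, add_zero, AlgEquiv.commutes]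
  induction i with
  | zero => simp
  | succ i ih =>
    rw [shiftX_zpow_succ, ih, key (fun k => t (k - i))]
    ext k
    rw [sub_sub, add_comm (1 : ℤ)]
  | pred i ih =>
    apply S.shiftX.injective
    rw [← shiftX_zpow_succ, sub_add_cancel, ih, key (fun k => t (k - (-i - 1)))]
    ext k
    congr 2
    ring

end Comparison

/-! ### The actions of `A((X;σ,δ))` and of `F((X))` on `V((X))` -/

namespace SkewLaurent

variable {F A : Type*} [Field F] [Ring A] [Algebra F A] {S : LeftSkewDerivation F A}

/-- The inclusion of `F((X))` in `A((X;σ,δ))`. -/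
noncomputable def ofLaurent (l : LaurentSeries F) : SkewLaurent S := ⟨l.map (algebraMap F A)⟩

/-- The inclusion of `A[X;σ,δ]` in `A((X;σ,δ))`. -/
noncomputable def ofSkewPoly (f : SkewPoly S) : SkewLaurent S :=
  ⟨(HahnModule.of F).symm (PolynomialModule.ofCoeff F f.coeff).toLaurent⟩

theorem ofSkewPoly_monomial_zero (a : A) :
    ofSkewPoly (SkewPoly.monomial 0 a : SkewPoly S) = monomial 0 a :=
  SkewLaurent.ext <| HahnSeries.coeff_inj.1 <|
    (extendInt_single 0 a).trans (coeff_single_eq 0 a).symm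

theorem series_coeff_sum {ι : Type*} (s : Finset ι) (f : ι → SkewLaurent S) (n : ℤ) :
    (∑ i ∈ s, f i).series.coeff n = ∑ i ∈ s, (f i).series.coeff n :=
  map_sum (AddMonoidHom.mk' (fun t : SkewLaurent S => t.series.coeff n) fun _ _ => rfl) f s

variable [S.IsBiNilpotent]

theorem coeff_monomial_zero_mul (a : A) (t : SkewLaurent S) (n : ℤ) :
    (monomial 0 a * t).series.coeff n = a * t.series.coeff n := by
  rw [series_mul, coeff_laurentMul, monomial, coeff_single_eq]
  refine (finsum_eq_single _ 0 fun i hi => by rw [Pi.single_eq_of_ne hi, smul_zero]).trans ?_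
  rw [Pi.single_eq_same, op_smul_eq_mul]
  rfl

/-- Over an `F`-basis `e` of `A`, a skew Laurent series is `∑ e_r t_r` with `t_r ∈ F((X))`. -/
theorem eq_sum_basis {ι : Type*} [Fintype ι] (e : Module.Basis ι F A) (t : SkewLaurent S) :
    t = ∑ r, monomial 0 (e r) * ofLaurent (t.series.map (e.coord r)) := by
  refine SkewLaurent.ext (HahnSeries.ext (funext fun n => ?_))
  rw [series_coeff_sum]
  simp only [coeff_monomial_zero_mul]
  conv_lhs => rw [← e.sum_repr (t.series.coeff n)]
  refine Finset.sum_congr rfl fun r _ => ?_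
  change _ = e r * algebraMap F A (e.repr (t.series.coeff n) r)
  rw [← Algebra.commutes, Algebra.smul_def]

variable {V : Type*} [AddCommGroup V] [Module F V] [Module Aᵐᵒᵖ V]

theorem toLaurent_op_smul (f : SkewPoly S) (p : PolynomialModule F V) :
    (op f • p).toLaurent = op (ofSkewPoly f) • p.toLaurent :=
  HahnModule.ext _ _ (S.laurentAct_extendInt p.coeff f.coeff).symm

variable [IsScalarTower F Aᵐᵒᵖ V]

/-- The action of `F((X))` on `V((X))` is the restriction of that of `A((X;σ,δ))`. -/
theorem op_ofLaurent_smul (l : LaurentSeries F) (s : HahnModule ℤ F V) :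
    op (ofLaurent l : SkewLaurent S) • s = l • s := by
  ext n
  rw [HahnModule.coeff_smul_eq_finsum]
  refine finsum_congr fun i => ?_
  change op ((S.shiftX ^ i) (fun k => algebraMap F A (l.coeff k)) n) • _ = _
  rw [shiftX_zpow_algebraMap, ← MulOpposite.algebraMap_apply, IsScalarTower.algebraMap_smul]

/-- If `t = ∑ e_r t_r` with `t_r ∈ F((X))`, then `s t = ∑ t_r (s e_r)`. -/
theorem op_smul_eq_sum {ι : Type*} [Fintype ι] (e : Module.Basis ι F A) (t : SkewLaurent S)
    (s : HahnModule ℤ F V) :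
    op t • s = ∑ r, t.series.map (e.coord r) • op (monomial 0 (e r) : SkewLaurent S) • s := by
  conv_lhs => rw [eq_sum_basis e t]
  rw [Finset.op_sum, Finset.sum_smul]
  exact Finset.sum_congr rfl fun r _ => by rw [op_mul, mul_smul, op_ofLaurent_smul]

/-- For finite-dimensional `A`, an `F((X))`-subspace containing `s A` contains
`s A((X;σ,δ))`. -/
theorem op_smul_mem [FiniteDimensional F A] {W : Submodule (LaurentSeries F) (HahnModule ℤ F V)}
    {s : HahnModule ℤ F V} (h : ∀ a : A, op (monomial 0 a : SkewLaurent S) • s ∈ W)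
    (t : SkewLaurent S) : op t • s ∈ W := by
  rw [op_smul_eq_sum (Module.finBasis F A)]
  exact Submodule.sum_mem _ fun r _ => W.smul_mem _ (h _)

open PolynomialModule in
/-- The span of a right `A`-stable module of polynomial vectors is a right
`A((X;σ,δ))`-submodule. -/
theorem op_smul_mem_laurentSpan [FiniteDimensional F A]
    {N : Submodule (Polynomial F) (PolynomialModule F V)}
    (hN : ∀ p ∈ N, ∀ a : A, op (SkewPoly.monomial 0 a : SkewPoly S) • p ∈ N)
    {s : HahnModule ℤ F V} (hs : s ∈ laurentSpan N) (t : SkewLaurent S) :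
    op t • s ∈ laurentSpan N := by
  induction hs using Submodule.span_induction generalizing t with
  | mem s hs =>
    obtain ⟨p, hp, rfl⟩ := hs
    refine op_smul_mem (fun a => ?_) t
    rw [← ofSkewPoly_monomial_zero, ← toLaurent_op_smul]
    exact toLaurent_mem_laurentSpan (hN p hp a)
  | zero => rw [smul_zero]; exact zero_mem _
  | add s s' _ _ h h' => rw [smul_add]; exact add_mem (h t) (h' t)
  | smul l s _ h =>
    -- `(l s) t = s (l t)`, which the induction hypothesis covers as it allows any multiplier.
    rw [← op_ofLaurent_smul (S := S) l s, ← mul_smul, ← op_mul]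
    exact h _

end SkewLaurent

end LeftSkewDerivation

/-! ### Convolutional codes and direct summands -/

/-- A convolutional code is a `k`-dimensional subspace spanned by its polynomial vectors. -/
theorem IsConvolutionalCode.exists_submodule {F : Type*} [Field F] {n k : ℕ}
    {D : Set (HahnModule ℤ F (Fin n → F))} (hD : IsConvolutionalCode k D) :
    ∃ W : Submodule (LaurentSeries F) (HahnModule ℤ F (Fin n → F)), (W : Set _) = D ∧
      PolynomialModule.laurentSpan (PolynomialModule.comapLaurent W) = W ∧
      Module.finrank (LaurentSeries F) W = k := by
  obtain ⟨W, b, hW, hb⟩ := hD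
  exact ⟨W, hW, PolynomialModule.laurentSpan_comapLaurent b hb,
    by rw [Module.finrank_eq_card_basis b, Fintype.card_fin]⟩

/-- An `F[X]`-basis of a direct summand is an `F((X))`-basis of its span. -/
theorem isConvolutionalCode_laurentSpan {F : Type*} [Field F] {n : ℕ}
    {N N' : Submodule (Polynomial F) (PolynomialModule F (Fin n → F))} (h : IsCompl N N') :
    IsConvolutionalCode (Module.finrank (Polynomial F) N)
      (PolynomialModule.laurentSpan N : Set (HahnModule ℤ F (Fin n → F))) := by
  let b := Module.finBasis (Polynomial F) N
  let v : Fin (Module.finrank (Polynomial F) N) → PolynomialModule.laurentSpan N :=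
    fun i => ⟨_, PolynomialModule.toLaurent_mem_laurentSpan (b i).2⟩
  have hv : ⊤ ≤ Submodule.span (LaurentSeries F) (Set.range v) := by
    refine (Submodule.map_injective_of_injective
      (PolynomialModule.laurentSpan N).subtype_injective ?_).ge
    rw [Submodule.map_span, ← Set.range_comp, Submodule.map_top, Submodule.range_subtype]
    exact (PolynomialModule.laurentSpan_eq_span_range b).symm
  refine ⟨_, basisOfTopLeSpanOfCardEqFinrank v hv ?_, rfl, fun i => ⟨b i, ?_⟩⟩
  · rw [Fintype.card_fin, (PolynomialModule.laurentSpan_of_isCompl h).1]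
  · rw [coe_basisOfTopLeSpanOfCardEqFinrank]

open PolynomialModule LeftSkewDerivation in
theorem mainTheorem5 {F A : Type*} [Field F] [Ring A] [Algebra F A] [FiniteDimensional F A]
    (S : LeftSkewDerivation F A) [S.IsBiNilpotent]
    (n k : ℕ) [Module Aᵐᵒᵖ (Fin n → F)] [IsScalarTower F Aᵐᵒᵖ (Fin n → F)] :
    Set.BijOn
      (fun D : Set (HahnModule ℤ F (Fin n → F)) =>
        {p : PolynomialModule F (Fin n → F) | p.toLaurent ∈ D})
      {D | IsCyclicConvolutionalCode S k D}
      {C | (∃ N : Submodule (S.SkewPoly)ᵐᵒᵖ (PolynomialModule F (Fin n → F)),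
          (N : Set (PolynomialModule F (Fin n → F))) = C) ∧ IsDirectSummandOfRank k C} := by
  refine ⟨?_, ?_, ?_⟩
  · rintro _ ⟨hD, hA⟩
    obtain ⟨W, rfl, hspan, hrank⟩ := hD.exists_submodule
    refine ⟨⟨{ comapLaurent W with
        smul_mem' := fun f p hp => ?_ }, rfl⟩, ?_⟩
    · change (op f.unop • p).toLaurent ∈ W
      rw [SkewLaurent.toLaurent_op_smul]
      exact SkewLaurent.op_smul_mem (fun a => hA _ hp a) _
    · obtain ⟨N', hN'⟩ := exists_isCompl_comapLaurent W
      exact ⟨comapLaurent W, N', rfl, hN', by rw [← (laurentSpan_of_isCompl hN').1, hspan, hrank]⟩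
  · rintro _ ⟨hD, -⟩ _ ⟨hD', -⟩ h
    obtain ⟨W, rfl, hspan, -⟩ := hD.exists_submodule
    obtain ⟨W', rfl, hspan', -⟩ := hD'.exists_submodule
    have h' : comapLaurent W = comapLaurent W' := SetLike.coe_injective h
    rw [← hspan, h', hspan']
  · rintro _ ⟨⟨N₀, hN₀⟩, N, N', rfl, hN, rfl⟩
    refine ⟨laurentSpan N, ⟨isConvolutionalCode_laurentSpan hN, fun s hs a => ?_⟩, ?_⟩
    swap
    · change (comapLaurent (laurentSpan N) : Set (PolynomialModule F (Fin n → F))) = N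
      rw [comapLaurent_laurentSpan hN]
    refine SkewLaurent.op_smul_mem_laurentSpan (fun p hp b => ?_) hs _
    rw [← SetLike.mem_coe, ← hN₀] at hp ⊢
    exact N₀.smul_mem _ hp
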